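/- Fix $\sigma\in(0,1)$ and let $u(q)=q^{\sigma}/\sigma$ for $q\ge 0$. Let $\mathcal C_{cx}$ be the set of all non-constant, weakly increasing, weakly convex cost functions $c:\mathbb R_+\to\mathbb R_+$ (the value $c(0)$ may be normalized to $0$, in which case non-constant means not identically $0$), with the $\sigma$-algebra generated by the evaluations $c\mapsto c(q)$, and let $\Delta(\mathcal C_{cx})$ be the set of probability measures on it. A mechanism is a function $t:\mathbb R_+\to\mathbb R_+$ with $t(0)=0$. Facing $t$, a seller with cost $c$ supplies the smallest maximizer $q(c,t)$ of $t(q)-c(q)$ over $q\ge 0$, and the buyer surplus is $U(c,t)=u(q(c,t))-t(q(c,t))$. For $z\in[0,1]$ write $U(c,z)$ for the buyer surplus under the constant share mechanism $t(q)=z\,u(q)$. For $G\in\Delta(\mathcal C_{cx})$ let $$U^*(G)=\sup_t\int U(c,t)\,dG(c),$$ the supremum being over all mechanisms $t$ for which the integral is well defined in $[-\infty,\infty]$ (in particular, $q(c,t)$ exists for $G$-almost every $c$). Then $$\min_{G}\ \sup_{z\in[0,1]}\frac{\int U(c,z)\,dG(c)}{U^*(G)}=\widehat B(\sigma):=\frac{1}{\sigma^{-\sigma/(1-\sigma)}-\sigma-\log(1-\sigma)},$$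 where the minimum is over all $G\in\Delta(\mathcal C_{cx})$ with $U^*(G)<\infty$. Moreover, for every such $G$ some $z\in[0,1]$ attains a ratio of at least $\widehat B(\sigma)$, and the minimum is attained at some $G$ concentrated on costs with $c(0)=0$ for which the supremum over $z$ is a maximum. -/

import Mathlib

open MeasureTheory Set
open scoped NNReal ENNReal

noncomputable section

namespace Procurement

/-- The buyer's gross utility `u(q) = q ^ σ / σ` of a quantity `q ≥ 0`. -/
def utility (σ : ℝ) (q : ℝ≥0) : ℝ := (q : ℝ) ^ σ / σ

/-- The class `C_cx` of feasible cost functions `c : ℝ₊ → ℝ₊`: (weakly) increasing, (weakly)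
convex, and not constant.  For `c 0 = 0` the last condition says that `c` is not identically `0`;
it makes the efficient surplus finite.  The value of `c 0` plays no role in any definition below.
As a type, this set carries the cylinder σ-algebra, generated by the evaluations `c ↦ c q`. -/
def convexCosts : Set (ℝ≥0 → ℝ) :=
  {c | (∀ q, 0 ≤ c q) ∧ Monotone c ∧ ConvexOn ℝ≥0 univ c ∧ ∃ q, c 0 < c q}

/-- The seller's best responses: the maximizers of the profit `t(q) - c(q)` over `q ≥ 0`. -/
def bestResponses (c t : ℝ≥0 → ℝ) : Set ℝ≥0 :=
  {q | ∀ q', t q' - c q' ≤ t q - c q}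

/-- The supplied quantity `q(c, t)`: the smallest best response of the seller.
(It is used only where a smallest best response exists.) -/
def supply (c t : ℝ≥0 → ℝ) : ℝ≥0 := sInf (bestResponses c t)

/-- The buyer surplus `U(c, t) = u(q(c, t)) - t(q(c, t))`. -/
def buyerSurplus (σ : ℝ) (c t : ℝ≥0 → ℝ) : ℝ :=
  utility σ (supply c t) - t (supply c t)

/-- `∫ U(c, t)⁺ dG(c)`. -/
def expectedGain (σ : ℝ) (G : ProbabilityMeasure convexCosts) (t : ℝ≥0 → ℝ) : ℝ≥0∞ :=
  ∫⁻ c : convexCosts, ENNReal.ofReal (buyerSurplus σ c t) ∂(G : Measure convexCosts)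

/-- `∫ U(c, t)⁻ dG(c)`. -/
def expectedLoss (σ : ℝ) (G : ProbabilityMeasure convexCosts) (t : ℝ≥0 → ℝ) : ℝ≥0∞ :=
  ∫⁻ c : convexCosts, ENNReal.ofReal (-buyerSurplus σ c t) ∂(G : Measure convexCosts)

/-- The expected buyer surplus `∫ U(c, t) dG(c)`, as an extended real number. -/
def expectedSurplus (σ : ℝ) (G : ProbabilityMeasure convexCosts) (t : ℝ≥0 → ℝ) : EReal :=
  (expectedGain σ G t : EReal) - (expectedLoss σ G t : EReal)

/-- The mechanisms `t : ℝ₊ → ℝ₊` with `t(0) = 0` for which `∫ U(c, t) dG(c)` is meaningful: for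
`G`-almost every cost the seller has a smallest best response, the buyer surplus is a
`G`-measurable function of the cost, and its positive and negative parts do not both have an
infinite integral. -/
def mechanisms (σ : ℝ) (G : ProbabilityMeasure convexCosts) : Set (ℝ≥0 → ℝ) :=
  {t | t 0 = 0 ∧ (∀ q, 0 ≤ t q) ∧
    (∀ᵐ c : convexCosts ∂(G : Measure convexCosts),
      ∃ q, IsLeast (bestResponses (c : ℝ≥0 → ℝ) t) q) ∧
    AEMeasurable (fun c : convexCosts => buyerSurplus σ c t) (G : Measure convexCosts) ∧
    (expectedGain σ G t ≠ ⊤ ∨ expectedLoss σ G t ≠ ⊤)}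

/-- The Bayes-optimal buyer surplus `U*(G) = sup_t ∫ U(c, t) dG(c)`. -/
def bayesSurplus (σ : ℝ) (G : ProbabilityMeasure convexCosts) : EReal :=
  ⨆ t ∈ mechanisms σ G, expectedSurplus σ G t

/-- The cost distributions for which the benchmark `U*(G)` is finite. -/
def priors (σ : ℝ) : Set (ProbabilityMeasure convexCosts) :=
  {G | bayesSurplus σ G < ⊤}

/-- The constant share mechanism `t(q) = z * u(q)`. -/
def constantShare (σ z : ℝ) : ℝ≥0 → ℝ := fun q => z * utility σ q

/-- The ratio `∫ U(c, z) dG(c) / U*(G)`. -/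
def shareRatio (σ : ℝ) (G : ProbabilityMeasure convexCosts) (z : ℝ) : EReal :=
  expectedSurplus σ G (constantShare σ z) / bayesSurplus σ G

/-- The saddle-point value `B̂(σ) = 1 / (σ ^ (-σ / (1 - σ)) - σ - log (1 - σ))`. -/
def saddleValue (σ : ℝ) : ℝ :=
  1 / (σ ^ (-σ / (1 - σ)) - σ - Real.log (1 - σ))

end Procurement

end

/-!
The efficient surplus `V(c) = max_q (u(q) - c(q)) + c(0)` of a cost `c` bounds the buyer surplus
under every mechanism, so `U*(G) ≤ ∫ V dG`. For the guarantee, let `P(z)` be the profit of the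
seller under the share `z` and `g(z) = u(q(c, z))` the utility supplied. By the envelope theorem
`g(z)` is a subgradient of `P` at `z`, hence `P(σ) - P(0) = ∫ z in 0..σ, g z`. Since `c` is convex,
it lies above its tangent of slope `σ u'(q(c, σ))`, and comparison with this linear continuation
bounds `P(1) - P(σ)` by `tailWeight σ * g σ`. Together this bounds `V(c)` by a combination of the
numbers `g z` with `z ∈ (0, σ]` (`efficientSurplus_le`). The buyer surplus under `z` is
`(1 - z) * g z`. If its mean were below `B̂(σ) U*(G)` for all `z`, then integrating the bound over
`G`, with `∫ z in 0..σ, 1 / (1 - z) = -log (1 - σ)`, would give `∫ V dG < U*(G)`, which is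
impossible (`exists_saddleValue_le_shareRatio`).

The bounds are tight for a single cost function, `worstCost`: it is chosen such that the surplus
`(1 - z) * g z` is the constant `1 / σ` on `(0, σ]`, that is `q(c, z) ^ σ = 1 / (1 - z)`, and such
that it is linear beyond `q(c, σ)`. Against the prior concentrated on it, a buyer can
extract all of the efficient surplus up to an arbitrarily small amount
(`le_bayesSurplus_pointPrior`), but no constant share yields more than `1 / σ`
(`buyerSurplus_worstCost_le`).
-/

namespace Procurement

/-! ### The utility function -/

lemma utility_nonneg {σ : ℝ} (hσ : 0 < σ) (q : ℝ≥0) : 0 ≤ utility σ q := by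
  unfold utility; positivity

lemma utility_zero {σ : ℝ} (hσ : 0 < σ) : utility σ 0 = 0 := by
  simp [utility, hσ.ne']

lemma continuous_utility {σ : ℝ} (hσ : 0 < σ) : Continuous (utility σ) := by
  unfold utility
  exact (NNReal.continuous_coe.rpow_const fun _ => Or.inr hσ.le).div_const _

lemma utility_mono {σ : ℝ} (hσ : 0 < σ) : Monotone (utility σ) := by
  intro x y hxy
  unfold utility
  have : (x : ℝ) ≤ y := hxy
  gcongr

/-- The power function lies below its tangent line at `y`. -/
lemma rpow_le_tangent {σ x y : ℝ} (hσ0 : 0 < σ) (hσ1 : σ < 1) (hx : 0 ≤ x) (hy : 0 < y) :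
    x ^ σ ≤ y ^ σ + σ * y ^ (σ - 1) * (x - y) := by
  have h := rpow_one_add_le_one_add_mul_self (s := x / y - 1) (by
    have : 0 ≤ x / y := by positivity
    linarith) hσ0.le hσ1.le
  have h2 : (1 + (x / y - 1)) = x / y := by ring
  rw [h2, Real.div_rpow hx hy.le, div_le_iff₀ (by positivity)] at h
  refine h.trans (le_of_eq ?_)
  rw [Real.rpow_sub_one hy.ne']
  field_simp

lemma utility_le_tangent {σ : ℝ} (hσ0 : 0 < σ) (hσ1 : σ < 1) (x : ℝ≥0) {y : ℝ} (hy : 0 < y) :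
    utility σ x ≤ y ^ σ / σ + y ^ (σ - 1) * (x - y) := by
  unfold utility
  rw [div_le_iff₀ hσ0]
  refine (rpow_le_tangent hσ0 hσ1 x.coe_nonneg hy).trans (le_of_eq ?_)
  field_simp

lemma constantShare_zero {σ z : ℝ} (hσ : 0 < σ) : constantShare σ z 0 = 0 := by
  simp [constantShare, utility_zero hσ]

/-! ### Convex cost functions -/

/-- A feasible cost function, extended by its value at `0` to negative quantities, is convex on the
whole real line: convexity survives at `0` because the cost is increasing. -/
lemma convexOn_toNNReal {c : ℝ≥0 → ℝ} (hc : c ∈ convexCosts) :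
    ConvexOn ℝ univ (fun x : ℝ => c x.toNNReal) := by
  obtain ⟨-, hm, hcx, -⟩ := hc
  refine ⟨convex_univ, fun x _ y _ a b ha hb hab => ?_⟩
  lift a to ℝ≥0 using ha
  lift b to ℝ≥0 using hb
  have h := hcx.2 (mem_univ x.toNNReal) (mem_univ y.toNNReal) zero_le zero_le
    (by exact_mod_cast hab)
  refine (hm ?_).trans h
  rw [Real.toNNReal_le_iff_le_coe]
  simp only [smul_eq_mul, NNReal.coe_add, NNReal.coe_mul]
  gcongr <;> exact Real.le_coe_toNNReal _

lemma continuous_of_mem_convexCosts {c : ℝ≥0 → ℝ} (hc : c ∈ convexCosts) : Continuous c := by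
  have h : Continuous (fun x : ℝ => c x.toNNReal) :=
    (convexOn_toNNReal hc).locallyLipschitz.continuous
  simpa [Function.comp_def] using h.comp NNReal.continuous_coe

lemma convexCosts_le_combo {c : ℝ≥0 → ℝ} (hc : c ∈ convexCosts) (x y : ℝ≥0) {s : ℝ}
    (h0 : 0 ≤ s) (h1 : s ≤ 1) :
    c ((x : ℝ) + s * (y - x)).toNNReal ≤ c x + s * (c y - c x) := by
  have h := (convexOn_toNNReal hc).2 (mem_univ (x : ℝ)) (mem_univ (y : ℝ))
    (sub_nonneg.2 h1) h0 (by ring)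
  simp only [smul_eq_mul, Real.toNNReal_coe] at h
  rw [show (x : ℝ) + s * (y - x) = (1 - s) * x + s * y by ring]
  linarith

/-- A non-constant convex cost grows at least linearly. -/
lemma exists_linear_le {c : ℝ≥0 → ℝ} (hc : c ∈ convexCosts) :
    ∃ a : ℝ, 0 < a ∧ ∃ b : ℝ, ∀ x : ℝ≥0, a * x - b ≤ c x := by
  obtain ⟨p, hp⟩ := hc.2.2.2
  have hp0 : 0 < (p : ℝ) := by
    rcases eq_or_ne p 0 with rfl | h
    · exact absurd hp (lt_irrefl _)
    · exact_mod_cast pos_iff_ne_zero.2 h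
  have ha : 0 < (c p - c 0) / p := div_pos (sub_pos.2 hp) hp0
  refine ⟨(c p - c 0) / p, ha, c p - c 0, fun x => ?_⟩
  rcases le_total x p with hx | hx
  · have h1 : (c p - c 0) / p * x ≤ (c p - c 0) / p * p := by gcongr
    rw [div_mul_cancel₀ _ hp0.ne'] at h1
    linarith [hc.1 x]
  · have hx' : (p : ℝ) ≤ x := by exact_mod_cast hx
    have hx0 : 0 < (x : ℝ) := hp0.trans_le hx'
    have h := convexCosts_le_combo hc 0 x (s := p / x) (by positivity) ((div_le_one hx0).2 hx')
    have e : (((0 : ℝ≥0) : ℝ) + (p : ℝ) / x * (x - ((0 : ℝ≥0) : ℝ))) = p := by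
      simp [hx0.ne']
    rw [e, Real.toNNReal_coe] at h
    have h2 : (c p - c 0) / p * x ≤ c x - c 0 := by
      rw [div_mul_eq_mul_div, div_le_iff₀ hp0]
      have : (c p - c 0) ≤ p / x * (c x - c 0) := by linarith
      rw [div_mul_eq_mul_div, le_div_iff₀ hx0] at this
      linarith
    linarith [hc.1 0]

/-! ### The supply under a constant share -/

lemma continuous_profit {σ : ℝ} (hσ : 0 < σ) {c : ℝ≥0 → ℝ} (hc : c ∈ convexCosts) (z : ℝ) :
    Continuous (fun q => constantShare σ z q - c q) :=
  ((continuous_utility hσ).const_mul z).sub (continuous_of_mem_convexCosts hc)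

/-- Under a constant share mechanism the profit tends to `-∞`: the utility grows sublinearly and
the cost at least linearly. -/
lemma tendsto_profit_atBot {σ : ℝ} (hσ0 : 0 < σ) (hσ1 : σ < 1) {c : ℝ≥0 → ℝ}
    (hc : c ∈ convexCosts) (z : ℝ) :
    Filter.Tendsto (fun q => constantShare σ z q - c q) Filter.atTop Filter.atBot := by
  obtain ⟨a, ha, b, hab⟩ := exists_linear_le hc
  -- the tangent of the utility at `y`, where `y ^ (σ - 1) = a / (2 * (|z| + 1))`
  set w : ℝ := a / (2 * (|z| + 1)) with hw
  have hz : 0 < |z| + 1 := by positivity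
  have hw0 : 0 < w := by positivity
  set y : ℝ := w ^ (1 / (σ - 1)) with hy
  have hy0 : 0 < y := Real.rpow_pos_of_pos hw0 _
  have hyw : y ^ (σ - 1) = w := by
    rw [hy, ← Real.rpow_mul hw0.le, one_div_mul_cancel (by linarith), Real.rpow_one]
  have hlim : Filter.Tendsto (fun q : ℝ≥0 => -(a / 2) * (q : ℝ) + (|z| * (y ^ σ / σ) + b))
      Filter.atTop Filter.atBot := by
    apply Filter.tendsto_atBot_add_const_right
    exact Filter.Tendsto.const_mul_atTop_of_neg (by linarith)
      (NNReal.tendsto_coe_atTop.2 Filter.tendsto_id)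
  refine Filter.tendsto_atBot_mono (fun q => ?_) hlim
  have h1 := utility_le_tangent hσ0 hσ1 q hy0
  rw [hyw] at h1
  have h2 : z * utility σ q ≤ |z| * utility σ q := by
    gcongr
    · exact utility_nonneg hσ0 q
    · exact le_abs_self z
  have h3 : |z| * utility σ q ≤ |z| * (y ^ σ / σ + w * q) := by
    gcongr
    nlinarith [mul_pos hw0 hy0]
  have h4 : |z| * w ≤ a / 2 := by
    rw [hw, ← mul_div_assoc, div_le_div_iff₀ (by positivity) (by norm_num)]
    nlinarith
  have h5 : |z| * w * q ≤ a / 2 * q := by gcongr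
  have := hab q
  simp only [constantShare]
  nlinarith

lemma isClosed_bestResponses {σ : ℝ} (hσ : 0 < σ) {c : ℝ≥0 → ℝ} (hc : c ∈ convexCosts) (z : ℝ) :
    IsClosed (bestResponses c (constantShare σ z)) := by
  have : bestResponses c (constantShare σ z)
      = ⋂ q', {q | constantShare σ z q' - c q' ≤ constantShare σ z q - c q} := by
    ext q; simp [bestResponses]
  rw [this]
  exact isClosed_iInter fun q' => isClosed_le continuous_const (continuous_profit hσ hc z)

/-- Under a constant share mechanism every seller has a smallest best response. -/
lemma isLeast_supply {σ : ℝ} (hσ0 : 0 < σ) (hσ1 : σ < 1) {c : ℝ≥0 → ℝ} (hc : c ∈ convexCosts)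
    (z : ℝ) :
    IsLeast (bestResponses c (constantShare σ z)) (supply c (constantShare σ z)) := by
  refine (isClosed_bestResponses hσ0 hc z).isLeast_csInf ?_ (OrderBot.bddBelow _)
  refine (continuous_profit hσ0 hc z).exists_forall_ge' (x₀ := 0) ?_
  obtain ⟨R, hR⟩ := Filter.eventually_atTop.1
    ((tendsto_profit_atBot hσ0 hσ1 hc z).eventually_le_atBot (constantShare σ z 0 - c 0))
  refine Filter.mem_of_superset (isCompact_Icc (a := (0 : ℝ≥0)) (b := R)).compl_mem_cocompact ?_
  intro x hx
  exact hR x (le_of_lt (not_le.1 fun h => hx ⟨zero_le, h⟩))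

/-- The gross utility `u(q(c, z))` of the quantity supplied under the share `z`. -/
noncomputable def suppliedUtility (σ : ℝ) (c : ℝ≥0 → ℝ) (z : ℝ) : ℝ :=
  utility σ (supply c (constantShare σ z))

/-- The profit of the seller with cost `c` under the share `z`. -/
noncomputable def shareProfit (σ : ℝ) (c : ℝ≥0 → ℝ) (z : ℝ) : ℝ :=
  z * suppliedUtility σ c z - c (supply c (constantShare σ z))

lemma buyerSurplus_constantShare (σ : ℝ) (c : ℝ≥0 → ℝ) (z : ℝ) :
    buyerSurplus σ c (constantShare σ z) = (1 - z) * suppliedUtility σ c z := by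
  simp only [buyerSurplus, suppliedUtility, constantShare]; ring

lemma suppliedUtility_nonneg {σ : ℝ} (hσ : 0 < σ) (c : ℝ≥0 → ℝ) (z : ℝ) :
    0 ≤ suppliedUtility σ c z := utility_nonneg hσ _

lemma profit_le_shareProfit {σ : ℝ} (hσ0 : 0 < σ) (hσ1 : σ < 1) {c : ℝ≥0 → ℝ}
    (hc : c ∈ convexCosts) (z : ℝ) (x : ℝ≥0) :
    z * utility σ x - c x ≤ shareProfit σ c z :=
  (isLeast_supply hσ0 hσ1 hc z).1 x

/-- The envelope property: `u(q(c, z'))` is a subgradient of the profit at `z'`. -/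
lemma shareProfit_subgradient {σ : ℝ} (hσ0 : 0 < σ) (hσ1 : σ < 1) {c : ℝ≥0 → ℝ}
    (hc : c ∈ convexCosts) (z z' : ℝ) :
    shareProfit σ c z' + (z - z') * suppliedUtility σ c z' ≤ shareProfit σ c z := by
  have := profit_le_shareProfit hσ0 hσ1 hc z (supply c (constantShare σ z'))
  simp only [shareProfit, suppliedUtility] at *
  linarith

lemma supply_constantShare_zero {σ : ℝ} {c : ℝ≥0 → ℝ}
    (hc : c ∈ convexCosts) : supply c (constantShare σ 0) = 0 := by
  refine le_antisymm (csInf_le (OrderBot.bddBelow _) fun q => ?_) zero_le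
  have := hc.2.1 (zero_le (a := q))
  simp only [constantShare, zero_mul]
  linarith

/-- A positive share induces a positive quantity: the marginal utility is infinite at `0`, while a
convex cost has a finite slope there. -/
lemma supply_pos {σ : ℝ} (hσ0 : 0 < σ) (hσ1 : σ < 1) {c : ℝ≥0 → ℝ} (hc : c ∈ convexCosts)
    {z : ℝ} (hz : 0 < z) : 0 < supply c (constantShare σ z) := by
  rw [pos_iff_ne_zero]
  intro h0
  have hbest := (isLeast_supply hσ0 hσ1 hc z).1
  rw [h0] at hbest
  -- a quantity `x ≤ 1` with `x ^ (σ - 1) = M`, where `z / σ * M` exceeds the slope `c 1 - c 0`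
  have hd : 0 ≤ c 1 - c 0 := sub_nonneg.2 (hc.2.1 (zero_le (a := 1)))
  set M : ℝ := σ / z * (c 1 - c 0) + 1 with hM
  have hM1 : 1 ≤ M := by
    have : 0 ≤ σ / z * (c 1 - c 0) := by positivity
    linarith
  have hM0 : 0 < M := by linarith
  set x : ℝ := M ^ (1 / (σ - 1)) with hx
  have hx0 : 0 < x := Real.rpow_pos_of_pos hM0 _
  have hx1 : x ≤ 1 := Real.rpow_le_one_of_one_le_of_nonpos hM1
    (div_nonpos_of_nonneg_of_nonpos zero_le_one (by linarith))
  have hxM : x ^ (σ - 1) = M := by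
    rw [hx, ← Real.rpow_mul hM0.le, one_div_mul_cancel (by linarith), Real.rpow_one]
  have h1 := hbest x.toNNReal
  have h2 := convexCosts_le_combo hc 0 1 hx0.le hx1
  simp only [NNReal.coe_zero, NNReal.coe_one, sub_zero, mul_one, zero_add] at h2
  simp only [constantShare, utility_zero hσ0, mul_zero] at h1
  have h3 : utility σ x.toNNReal = x * M / σ := by
    rw [utility, Real.coe_toNNReal _ hx0.le, ← hxM, Real.rpow_sub_one hx0.ne']
    field_simp
  have h4 : z * (x * M / σ) = x * (c 1 - c 0) + z * x / σ := by
    rw [hM]; field_simp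
  rw [h3, h4] at h1
  have : 0 < z * x / σ := by positivity
  linarith

lemma suppliedUtility_pos {σ : ℝ} (hσ0 : 0 < σ) (hσ1 : σ < 1) {c : ℝ≥0 → ℝ}
    (hc : c ∈ convexCosts) {z : ℝ} (hz : 0 < z) : 0 < suppliedUtility σ c z := by
  have : 0 < ((supply c (constantShare σ z) : ℝ≥0) : ℝ) := supply_pos hσ0 hσ1 hc hz
  unfold suppliedUtility utility
  positivity

/-! ### Integrating a monotone family of subgradients -/

/-- If `g z` is a subgradient of `P` at every `z`, then `P` is an antiderivative of `g` in the
sense of integrals: `g` is monotone, so it is continuous off a countable set, and `P` has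
derivative `g z` at each continuity point `z`. -/
lemma integral_subgradient {P g : ℝ → ℝ} (h : ∀ z z', P z' + (z - z') * g z' ≤ P z) (a b : ℝ) :
    Monotone g ∧ ∫ z in a..b, g z = P b - P a := by
  have hmono : Monotone g := by
    intro x y hxy
    rcases hxy.eq_or_lt with rfl | hlt
    · exact le_rfl
    · nlinarith [h x y, h y x]
  have hcont : Continuous P := by
    rw [continuous_iff_continuousAt]
    intro x
    have key : ∀ᶠ z in nhds x, ‖P z - P x‖ ≤ (|g (x + 1)| + |g (x - 1)|) * |z - x| := by
      filter_upwards [Ioo_mem_nhds (show x - 1 < x by linarith) (show x < x + 1 by linarith)]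
        with z hz
      have h1 := h z x
      have h2 := h x z
      have h3 : |g x| ≤ |g (x + 1)| + |g (x - 1)| := by
        have := hmono (show x ≤ x + 1 by linarith)
        have := hmono (show x - 1 ≤ x by linarith)
        rw [abs_le]
        constructor <;>
          linarith [le_abs_self (g (x + 1)), neg_abs_le (g (x - 1)), abs_nonneg (g (x + 1)),
            abs_nonneg (g (x - 1))]
      have h4 : |g z| ≤ |g (x + 1)| + |g (x - 1)| := by
        have := hmono hz.2.le
        have := hmono hz.1.le
        rw [abs_le]
        constructor <;>
          linarith [le_abs_self (g (x + 1)), neg_abs_le (g (x - 1)), abs_nonneg (g (x + 1)),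
            abs_nonneg (g (x - 1))]
      have h5 : |(z - x) * g x| ≤ (|g (x + 1)| + |g (x - 1)|) * |z - x| := by
        rw [abs_mul, mul_comm]; gcongr
      have h6 : |(z - x) * g z| ≤ (|g (x + 1)| + |g (x - 1)|) * |z - x| := by
        rw [abs_mul, mul_comm]; gcongr
      rw [Real.norm_eq_abs, abs_le]
      constructor
      · linarith [neg_abs_le ((z - x) * g x)]
      · linarith [le_abs_self ((z - x) * g z)]
    have h0 : Filter.Tendsto (fun z => (|g (x + 1)| + |g (x - 1)|) * |z - x|) (nhds x)
        (nhds 0) := by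
      have : Continuous (fun z => (|g (x + 1)| + |g (x - 1)|) * |z - x|) := by fun_prop
      simpa using this.tendsto x
    have := squeeze_zero_norm' key h0
    simpa [ContinuousAt] using this.add_const (P x)
  refine ⟨hmono, integral_eq_of_hasDerivAt_off_countable P g hmono.countable_not_continuousAt
    hcont.continuousOn (fun x hx => ?_) hmono.intervalIntegrable⟩
  have hgx : ContinuousAt g x := by simpa using hx.2
  rw [hasDerivAt_iff_isLittleO, Asymptotics.isLittleO_iff]
  intro ε hε
  filter_upwards [Metric.tendsto_nhds.1 hgx ε hε] with z hz
  have h1 := h z x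
  have h2 := h x z
  rw [Real.dist_eq] at hz
  have h3 : |(z - x) * (g z - g x)| ≤ ε * |z - x| := by
    rw [abs_mul, mul_comm]; gcongr
  rw [Real.norm_eq_abs, Real.norm_eq_abs, smul_eq_mul, abs_of_nonneg (by linarith)]
  linarith [le_abs_self ((z - x) * (g z - g x))]

/-! ### The efficient surplus against the constant shares -/

/-- At the quantity `q` supplied under the share `z`, the marginal revenue `z u'(q)` is a
subgradient of the cost: move from `q` towards `x` and let the step tend to `0`. -/
lemma cost_subgradient {σ : ℝ} (hσ0 : 0 < σ) (hσ1 : σ < 1) {c : ℝ≥0 → ℝ} (hc : c ∈ convexCosts)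
    {z : ℝ} (hz : 0 < z) (x : ℝ≥0) :
    z * ((supply c (constantShare σ z) : ℝ) ^ (σ - 1) * (x - supply c (constantShare σ z)))
      ≤ c x - c (supply c (constantShare σ z)) := by
  have hq : 0 < ((supply c (constantShare σ z) : ℝ≥0) : ℝ) := supply_pos hσ0 hσ1 hc hz
  have hbest := (isLeast_supply hσ0 hσ1 hc z).1
  set q : ℝ≥0 := supply c (constantShare σ z)
  have hder : HasDerivAt (fun s : ℝ => ((q : ℝ) + s * (x - q)) ^ σ / σ)
      ((q : ℝ) ^ (σ - 1) * (x - q)) 0 := by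
    have h1 : HasDerivAt (fun s : ℝ => (q : ℝ) + s * (x - q)) ((x : ℝ) - q) 0 := by
      simpa using ((hasDerivAt_id (0 : ℝ)).mul_const ((x : ℝ) - q)).const_add (q : ℝ)
    have h2 := (h1.rpow_const (p := σ) (Or.inl (by simpa using hq.ne'))).div_const σ
    refine h2.congr_deriv ?_
    simp only [zero_mul, add_zero]
    field_simp
  refine le_of_tendsto ((hder.tendsto_slope_zero_right).const_mul z) ?_
  filter_upwards [Ioc_mem_nhdsGT (zero_lt_one (α := ℝ))] with s hs
  have hs0 : 0 < s := hs.1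
  have hnn : 0 ≤ (q : ℝ) + s * (x - q) := by
    have e : (q : ℝ) + s * (x - q) = (1 - s) * q + s * x := by ring
    rw [e]
    exact add_nonneg (mul_nonneg (sub_nonneg.2 hs.2) q.2) (mul_nonneg hs0.le x.2)
  have h1 := hbest ((q : ℝ) + s * (x - q)).toNNReal
  have h2 := convexCosts_le_combo hc q x hs0.le hs.2
  simp only [constantShare, utility, Real.coe_toNNReal _ hnn] at h1
  simp only [zero_add, zero_mul, add_zero, smul_eq_mul]
  have h3 : z * (s⁻¹ * (((q : ℝ) + s * (x - q)) ^ σ / σ - (q : ℝ) ^ σ / σ))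
      = (z * (((q : ℝ) + s * (x - q)) ^ σ / σ - (q : ℝ) ^ σ / σ)) / s := by
    field_simp
  rw [h3, div_le_iff₀ hs0]
  linarith

/-- The weight of the share `σ` in the bound on the efficient surplus. -/
noncomputable def tailWeight (σ : ℝ) : ℝ := (1 - σ) * (σ ^ (-σ / (1 - σ)) - σ)

lemma one_lt_rpow_saddle {σ : ℝ} (hσ0 : 0 < σ) (hσ1 : σ < 1) : 1 < σ ^ (-σ / (1 - σ)) :=
  Real.one_lt_rpow_of_pos_of_lt_one_of_neg hσ0 hσ1
    (div_neg_of_neg_of_pos (by linarith) (by linarith))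

lemma tailWeight_pos {σ : ℝ} (hσ0 : 0 < σ) (hσ1 : σ < 1) : 0 < tailWeight σ :=
  mul_pos (by linarith) (by linarith [one_lt_rpow_saddle hσ0 hσ1])

lemma rpow_neg_one_div {σ : ℝ} (hσ0 : 0 < σ) (hσ1 : σ < 1) :
    σ ^ (-1 / (1 - σ)) = σ ^ (-σ / (1 - σ)) / σ := by
  have : 1 - σ ≠ 0 := by linarith
  rw [← Real.rpow_sub_one hσ0.ne']
  congr 1
  field_simp
  ring

/-- Raising the share from `σ` to `1` gains a seller with a convex cost at most what it gains a
seller whose cost is linear beyond the quantity supplied under the share `σ`. -/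
lemma shareProfit_one_le {σ : ℝ} (hσ0 : 0 < σ) (hσ1 : σ < 1) {c : ℝ≥0 → ℝ}
    (hc : c ∈ convexCosts) :
    shareProfit σ c 1 ≤ shareProfit σ c σ + tailWeight σ * suppliedUtility σ c σ := by
  have hq : 0 < ((supply c (constantShare σ σ) : ℝ≥0) : ℝ) := supply_pos hσ0 hσ1 hc hσ0
  have hsub := cost_subgradient hσ0 hσ1 hc hσ0 (supply c (constantShare σ 1))
  set x : ℝ≥0 := supply c (constantShare σ 1) with hx
  simp only [shareProfit, suppliedUtility, one_mul, ← hx]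
  set q : ℝ≥0 := supply c (constantShare σ σ)
  -- `y` is the efficient quantity for the linear continuation: `y ^ (σ - 1) = σ q ^ (σ - 1)`
  set y : ℝ := σ ^ (-1 / (1 - σ)) * q with hy
  have hs : 0 < σ ^ (-1 / (1 - σ)) := Real.rpow_pos_of_pos hσ0 _
  have hy0 : 0 < y := mul_pos hs hq
  have h1σ : 1 - σ ≠ 0 := by linarith
  have hy1 : y ^ (σ - 1) = σ * (q : ℝ) ^ (σ - 1) := by
    rw [hy, Real.mul_rpow hs.le hq.le, ← Real.rpow_mul hσ0.le]
    rw [show -1 / (1 - σ) * (σ - 1) = 1 by field_simp; ring, Real.rpow_one]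
  have hy2 : y ^ σ = σ ^ (-σ / (1 - σ)) * (q : ℝ) ^ σ := by
    rw [hy, Real.mul_rpow hs.le hq.le, ← Real.rpow_mul hσ0.le]
    rw [show -1 / (1 - σ) * σ = -σ / (1 - σ) by ring]
  have hq1 : (q : ℝ) ^ (σ - 1) * q = (q : ℝ) ^ σ := by
    rw [Real.rpow_sub_one hq.ne']; field_simp
  have ht := utility_le_tangent hσ0 hσ1 x hy0
  rw [hy1, hy2] at ht
  have hyq : (q : ℝ) ^ (σ - 1) * y = σ ^ (-σ / (1 - σ)) / σ * (q : ℝ) ^ σ := by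
    rw [hy, rpow_neg_one_div hσ0 hσ1, ← hq1]; ring
  have e1 : σ * (q : ℝ) ^ (σ - 1) * (x - y)
      = σ * (q : ℝ) ^ (σ - 1) * x - σ ^ (-σ / (1 - σ)) * (q : ℝ) ^ σ := by
    rw [mul_sub, mul_assoc σ _ y, hyq]; field_simp
  have e2 : σ * ((q : ℝ) ^ (σ - 1) * (x - q)) = σ * (q : ℝ) ^ (σ - 1) * x - σ * (q : ℝ) ^ σ := by
    rw [mul_sub, hq1]; ring
  rw [e1] at ht
  rw [e2] at hsub
  have e3 : σ ^ (-σ / (1 - σ)) * (q : ℝ) ^ σ / σ - σ ^ (-σ / (1 - σ)) * (q : ℝ) ^ σ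
      + σ * (q : ℝ) ^ σ = σ * utility σ q + tailWeight σ * utility σ q := by
    simp only [utility, tailWeight]; field_simp; ring
  linarith

/-- The efficient surplus `max_q (u(q) - c(q)) + c(0)`. -/
noncomputable def efficientSurplus (σ : ℝ) (c : ℝ≥0 → ℝ) : ℝ := shareProfit σ c 1 + c 0

lemma suppliedUtility_mono {σ : ℝ} (hσ0 : 0 < σ) (hσ1 : σ < 1) {c : ℝ≥0 → ℝ}
    (hc : c ∈ convexCosts) : Monotone (suppliedUtility σ c) :=
  (integral_subgradient (shareProfit_subgradient hσ0 hσ1 hc) 0 0).1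

/-- The efficient surplus is bounded by a combination of the utilities supplied under the shares
`z ∈ (0, σ]`: the profit gained below the share `σ` is an integral of the supplied utility, the
profit gained beyond it is at most a multiple of the utility supplied under `σ`. -/
lemma efficientSurplus_le {σ : ℝ} (hσ0 : 0 < σ) (hσ1 : σ < 1) {c : ℝ≥0 → ℝ}
    (hc : c ∈ convexCosts) :
    ENNReal.ofReal (efficientSurplus σ c)
      ≤ (∫⁻ z in Ioc 0 σ, ENNReal.ofReal (suppliedUtility σ c z))
        + ENNReal.ofReal (tailWeight σ) * ENNReal.ofReal (suppliedUtility σ c σ) := by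
  have hmono := suppliedUtility_mono hσ0 hσ1 hc
  have hint := (integral_subgradient (shareProfit_subgradient hσ0 hσ1 hc) 0 σ).2
  have h0 : shareProfit σ c 0 = -c 0 := by
    simp [shareProfit, supply_constantShare_zero hc]
  rw [h0, intervalIntegral.integral_of_le hσ0.le] at hint
  have htail := shareProfit_one_le hσ0 hσ1 hc
  rw [← ofReal_integral_eq_lintegral_ofReal
      ((intervalIntegrable_iff_integrableOn_Ioc_of_le hσ0.le).1 hmono.intervalIntegrable)
      (Filter.Eventually.of_forall fun z => suppliedUtility_nonneg hσ0 c z),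
    ← ENNReal.ofReal_mul (tailWeight_pos hσ0 hσ1).le,
    ← ENNReal.ofReal_add (integral_nonneg fun z => suppliedUtility_nonneg hσ0 c z)
      (mul_nonneg (tailWeight_pos hσ0 hσ1).le (suppliedUtility_nonneg hσ0 c σ))]
  apply ENNReal.ofReal_le_ofReal
  rw [efficientSurplus]
  linarith

/-- No mechanism leaves the buyer more than the efficient surplus, as the seller can always supply
nothing. -/
lemma buyerSurplus_le {σ : ℝ} (hσ0 : 0 < σ) (hσ1 : σ < 1) {c t : ℝ≥0 → ℝ} (hc : c ∈ convexCosts)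
    (ht : t 0 = 0) (hs : ∃ q, IsLeast (bestResponses c t) q) :
    buyerSurplus σ c t ≤ efficientSurplus σ c := by
  obtain ⟨q, hq⟩ := hs
  have h1 := hq.1 0
  have h2 := profit_le_shareProfit hσ0 hσ1 hc 1 q
  rw [buyerSurplus, supply, hq.csInf_eq, efficientSurplus]
  linarith

/-! ### Measurability in the cost function -/

lemma measurable_eval (x : ℝ≥0) : Measurable (fun c : convexCosts => (c : ℝ≥0 → ℝ) x) :=
  (measurable_pi_apply x).comp measurable_subtype_coe

/-- Convex costs are continuous, so they are determined by countably many evaluations. -/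
instance : MeasurableSingletonClass convexCosts := by
  refine ⟨fun c => ?_⟩
  have : ({c} : Set convexCosts)
      = ⋂ n : ℕ, {c' : convexCosts | (c' : ℝ≥0 → ℝ) (TopologicalSpace.denseSeq ℝ≥0 n)
          = (c : ℝ≥0 → ℝ) (TopologicalSpace.denseSeq ℝ≥0 n)} := by
    ext c'
    simp only [mem_singleton_iff, mem_iInter, mem_ofPred_eq]
    refine ⟨fun h n => by rw [h], fun h => Subtype.ext ?_⟩
    exact (continuous_of_mem_convexCosts c'.2).ext_on (TopologicalSpace.denseRange_denseSeq ℝ≥0)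
      (continuous_of_mem_convexCosts c.2) (by rintro _ ⟨n, rfl⟩; exact h n)
  rw [this]
  exact MeasurableSet.iInter fun n =>
    measurableSet_eq_fun (measurable_eval _) measurable_const

/-- For a continuous function with a maximum, the smallest maximizer is at most `r` if and only if
the supremum over a dense sequence is not lowered by truncating the sequence at `r`. -/
lemma isLeast_maximizers_le_iff {f : ℝ≥0 → ℝ} (hf : Continuous f) {q : ℝ≥0}
    (hq : IsLeast {q | ∀ q', f q' ≤ f q} q) (r : ℝ≥0) :
    q ≤ r ↔ ⨆ n, f (TopologicalSpace.denseSeq ℝ≥0 n)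
      ≤ ⨆ n, f (min (TopologicalSpace.denseSeq ℝ≥0 n) r) := by
  have hsup : ∀ g : ℝ≥0 → ℝ, Continuous g → (∀ x, g x ≤ f q) →
      ∀ x, g x ≤ ⨆ n, g (TopologicalSpace.denseSeq ℝ≥0 n) := by
    intro g hg hb x
    have hbdd : BddAbove (range fun n => g (TopologicalSpace.denseSeq ℝ≥0 n)) :=
      ⟨f q, by rintro _ ⟨n, rfl⟩; exact hb _⟩
    have hcl : IsClosed {x | g x ≤ ⨆ n, g (TopologicalSpace.denseSeq ℝ≥0 n)} :=
      isClosed_le hg continuous_const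
    have : (univ : Set ℝ≥0) ⊆ {x | g x ≤ ⨆ n, g (TopologicalSpace.denseSeq ℝ≥0 n)} := by
      rw [← (TopologicalSpace.denseRange_denseSeq ℝ≥0).closure_range]
      refine hcl.closure_subset_iff.2 ?_
      rintro _ ⟨n, rfl⟩
      exact le_ciSup hbdd n
    exact this (mem_univ x)
  have hftrunc : Continuous fun x => f (min x r) := hf.comp (continuous_id.min continuous_const)
  have htrunc := hsup (fun x => f (min x r)) hftrunc (fun x => hq.1 _)
  constructor
  · intro hqr
    refine (ciSup_le fun n => hq.1 _).trans ?_
    simpa [min_eq_left hqr] using htrunc q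
  · intro h
    obtain ⟨m, hm, hmax⟩ := isCompact_Icc.exists_isMaxOn (nonempty_Icc.2 (zero_le (a := r)))
      hf.continuousOn
    have h1 : f q ≤ f m := by
      refine (hsup f hf hq.1 q).trans (h.trans (ciSup_le fun n => hmax ?_))
      exact ⟨zero_le, min_le_right _ _⟩
    exact (hq.2 fun q' => (hq.1 q').trans h1).trans hm.2

/-- The quantity supplied under a constant share is jointly measurable in the cost and the share. -/
lemma measurable_supply {σ : ℝ} (hσ0 : 0 < σ) (hσ1 : σ < 1) :
    Measurable (fun p : convexCosts × ℝ => supply p.1 (constantShare σ p.2)) := by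
  refine measurable_of_Iic fun r => ?_
  have hm : ∀ x : ℝ≥0, Measurable (fun p : convexCosts × ℝ =>
      constantShare σ p.2 x - (p.1 : ℝ≥0 → ℝ) x) := fun x =>
    (measurable_snd.mul_const _).sub ((measurable_eval x).comp measurable_fst)
  have : (fun p : convexCosts × ℝ => supply p.1 (constantShare σ p.2)) ⁻¹' Iic r
      = {p | ⨆ n, (constantShare σ p.2 (TopologicalSpace.denseSeq ℝ≥0 n)
              - (p.1 : ℝ≥0 → ℝ) (TopologicalSpace.denseSeq ℝ≥0 n))
          ≤ ⨆ n, (constantShare σ p.2 (min (TopologicalSpace.denseSeq ℝ≥0 n) r)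
              - (p.1 : ℝ≥0 → ℝ) (min (TopologicalSpace.denseSeq ℝ≥0 n) r))} := by
    ext p
    exact isLeast_maximizers_le_iff (continuous_profit hσ0 p.1.2 p.2)
      (isLeast_supply hσ0 hσ1 p.1.2 p.2) r
  rw [this]
  exact measurableSet_le (Measurable.iSup fun n => hm _) (Measurable.iSup fun n => hm _)

lemma measurable_suppliedUtility {σ : ℝ} (hσ0 : 0 < σ) (hσ1 : σ < 1) :
    Measurable (fun p : convexCosts × ℝ => suppliedUtility σ p.1 p.2) :=
  (continuous_utility hσ0).measurable.comp (measurable_supply hσ0 hσ1)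

lemma measurable_suppliedUtility_left {σ : ℝ} (hσ0 : 0 < σ) (hσ1 : σ < 1) (z : ℝ) :
    Measurable (fun c : convexCosts => suppliedUtility σ c z) :=
  Measurable.comp (g := fun p : convexCosts × ℝ => suppliedUtility σ p.1 p.2)
    (f := fun c => (c, z)) (measurable_suppliedUtility hσ0 hσ1) measurable_prodMk_right

/-! ### The guarantee of constant shares -/

/-- The mean utility supplied under the share `z`. -/
noncomputable def meanUtility (σ : ℝ) (G : ProbabilityMeasure convexCosts) (z : ℝ) : ℝ≥0∞ :=
  ∫⁻ c : convexCosts, ENNReal.ofReal (suppliedUtility σ c z) ∂(G : Measure convexCosts)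

lemma expectedLoss_constantShare {σ : ℝ} (hσ0 : 0 < σ) (G : ProbabilityMeasure convexCosts)
    {z : ℝ} (hz : z ≤ 1) : expectedLoss σ G (constantShare σ z) = 0 := by
  have : ∀ c : convexCosts, ENNReal.ofReal (-buyerSurplus σ c (constantShare σ z)) = 0 := by
    intro c
    rw [buyerSurplus_constantShare, ENNReal.ofReal_eq_zero]
    linarith [mul_nonneg (sub_nonneg.2 hz) (suppliedUtility_nonneg hσ0 c z)]
  simp [expectedLoss, this]

lemma expectedSurplus_constantShare {σ : ℝ} (hσ0 : 0 < σ) (G : ProbabilityMeasure convexCosts)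
    {z : ℝ} (hz : z ≤ 1) :
    expectedSurplus σ G (constantShare σ z)
      = ((ENNReal.ofReal (1 - z) * meanUtility σ G z : ℝ≥0∞) : EReal) := by
  rw [expectedSurplus, expectedLoss_constantShare hσ0 G hz, expectedGain, meanUtility,
    ← lintegral_const_mul' _ _ ENNReal.ofReal_ne_top]
  simp only [buyerSurplus_constantShare, ENNReal.ofReal_mul (sub_nonneg.2 hz)]
  simp

lemma constantShare_mem_mechanisms {σ : ℝ} (hσ0 : 0 < σ) (hσ1 : σ < 1)
    (G : ProbabilityMeasure convexCosts) {z : ℝ} (hz0 : 0 ≤ z) (hz1 : z ≤ 1) :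
    constantShare σ z ∈ mechanisms σ G := by
  refine ⟨constantShare_zero hσ0, fun q => mul_nonneg hz0 (utility_nonneg hσ0 q),
    Filter.Eventually.of_forall fun c => ⟨_, isLeast_supply hσ0 hσ1 c.2 z⟩, ?_, Or.inr ?_⟩
  · simp only [buyerSurplus_constantShare]
    exact ((measurable_suppliedUtility_left hσ0 hσ1 z).const_mul _).aemeasurable
  · rw [expectedLoss_constantShare hσ0 G hz1]
    exact ENNReal.zero_ne_top

lemma bayesSurplus_le {σ : ℝ} (hσ0 : 0 < σ) (hσ1 : σ < 1) (G : ProbabilityMeasure convexCosts) :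
    bayesSurplus σ G
      ≤ ((∫⁻ c : convexCosts, ENNReal.ofReal (efficientSurplus σ c) ∂(G : Measure convexCosts)
          : ℝ≥0∞) : EReal) := by
  refine iSup₂_le fun t ht => ?_
  have h1 : expectedSurplus σ G t ≤ (expectedGain σ G t : EReal) := by
    rw [expectedSurplus, sub_eq_add_neg]
    refine (add_le_add_right (EReal.neg_le_neg_iff.2 (EReal.coe_ennreal_nonneg _)) _).trans ?_
    simp
  refine h1.trans (EReal.coe_ennreal_le_coe_ennreal_iff.2 (lintegral_mono_ae ?_))
  filter_upwards [ht.2.2.1] with c hc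
  exact ENNReal.ofReal_le_ofReal (buyerSurplus_le hσ0 hσ1 c.2 ht.1 hc)

lemma bayesSurplus_pos {σ : ℝ} (hσ0 : 0 < σ) (hσ1 : σ < 1) (G : ProbabilityMeasure convexCosts) :
    0 < bayesSurplus σ G := by
  have h1 : expectedSurplus σ G (constantShare σ σ) ≤ bayesSurplus σ G :=
    le_iSup₂_of_le _ (constantShare_mem_mechanisms hσ0 hσ1 G hσ0.le hσ1.le) le_rfl
  refine lt_of_lt_of_le ?_ h1
  rw [expectedSurplus_constantShare hσ0 G hσ1.le, EReal.coe_ennreal_pos]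
  refine ENNReal.mul_pos (ENNReal.ofReal_pos.2 (by linarith)).ne' (fun h => ?_)
  rw [meanUtility, lintegral_eq_zero_iff
    (measurable_suppliedUtility_left hσ0 hσ1 σ).ennreal_ofReal] at h
  obtain ⟨c, hc⟩ := h.exists
  exact (suppliedUtility_pos hσ0 hσ1 c.2 hσ0).not_ge (ENNReal.ofReal_eq_zero.1 hc)

/-- The denominator of the saddle value. -/
noncomputable def saddleDenom (σ : ℝ) : ℝ := σ ^ (-σ / (1 - σ)) - σ - Real.log (1 - σ)

lemma saddleValue_eq (σ : ℝ) : saddleValue σ = 1 / saddleDenom σ := rfl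

lemma saddleDenom_pos {σ : ℝ} (hσ0 : 0 < σ) (hσ1 : σ < 1) : 0 < saddleDenom σ := by
  have := Real.log_neg (show 0 < 1 - σ by linarith) (by linarith)
  have := one_lt_rpow_saddle hσ0 hσ1
  unfold saddleDenom
  linarith

lemma lintegral_div_one_sub {σ s : ℝ} (hσ0 : 0 < σ) (hσ1 : σ < 1) (hs : 0 ≤ s) :
    ∫⁻ z in Ioc 0 σ, ENNReal.ofReal (s / (1 - z))
      = ENNReal.ofReal (s * -Real.log (1 - σ)) := by
  have hne : ∀ z ∈ uIcc 0 σ, 1 - z ≠ 0 := fun z hz => by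
    rw [uIcc_of_le hσ0.le] at hz
    linarith [hz.2]
  have hcont : ContinuousOn (fun z : ℝ => s / (1 - z)) (uIcc 0 σ) :=
    continuousOn_const.div (by fun_prop) hne
  have hint : ∫ z in (0 : ℝ)..σ, s / (1 - z) = s * -Real.log (1 - σ) := by
    rw [intervalIntegral.integral_eq_sub_of_hasDerivAt (f := fun z => s * -Real.log (1 - z))
      (fun z hz => ?_) hcont.intervalIntegrable]
    · simp
    · have h1 := ((((hasDerivAt_id z).const_sub 1).log (hne z hz)).neg).const_mul s
      refine h1.congr_deriv ?_
      simp only [id_eq]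
      ring
  rw [← hint, intervalIntegral.integral_of_le hσ0.le,
    ofReal_integral_eq_lintegral_ofReal
      ((intervalIntegrable_iff_integrableOn_Ioc_of_le hσ0.le).1 hcont.intervalIntegrable)]
  filter_upwards [ae_restrict_mem measurableSet_Ioc] with z hz
  exact div_nonneg hs (by linarith [hz.2])

lemma lintegral_efficientSurplus_le {σ : ℝ} (hσ0 : 0 < σ) (hσ1 : σ < 1)
    (G : ProbabilityMeasure convexCosts) :
    ∫⁻ c : convexCosts, ENNReal.ofReal (efficientSurplus σ c) ∂(G : Measure convexCosts)
      ≤ (∫⁻ z in Ioc 0 σ, meanUtility σ G z)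
        + ENNReal.ofReal (tailWeight σ) * meanUtility σ G σ := by
  refine (lintegral_mono fun c => efficientSurplus_le hσ0 hσ1 c.2).trans (le_of_eq ?_)
  rw [lintegral_add_right _ ((measurable_suppliedUtility_left hσ0 hσ1 σ).ennreal_ofReal.const_mul _),
    lintegral_const_mul' _ _ ENNReal.ofReal_ne_top, lintegral_lintegral_swap]
  · rfl
  · exact (measurable_suppliedUtility hσ0 hσ1).ennreal_ofReal.aemeasurable

/-- For every prior some constant share guarantees the saddle value. If every share fell short,
the mean utility supplied under `z` would be less than `s / (1 - z)` for all `z ∈ (0, σ]`, where `s`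
is the saddle value times the benchmark, and the bound on the efficient surplus would put it below
the benchmark. -/
theorem exists_saddleValue_le_shareRatio {σ : ℝ} (hσ0 : 0 < σ) (hσ1 : σ < 1)
    {G : ProbabilityMeasure convexCosts} (hG : G ∈ priors σ) :
    ∃ z ∈ Icc (0 : ℝ) 1, (saddleValue σ : EReal) ≤ shareRatio σ G z := by
  by_contra! hcon
  have hD := saddleDenom_pos hσ0 hσ1
  have hpos := bayesSurplus_pos hσ0 hσ1 G
  have hle := bayesSurplus_le hσ0 hσ1 G
  have htop : bayesSurplus σ G < ⊤ := hG
  obtain ⟨r, hr⟩ : ∃ r : ℝ, bayesSurplus σ G = r :=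
    ⟨_, (EReal.coe_toReal htop.ne (ne_bot_of_gt hpos)).symm⟩
  rw [hr] at hpos hle
  have hr0 : 0 < r := by exact_mod_cast hpos
  set s : ℝ := saddleValue σ * r with hs
  have hs0 : 0 < s := mul_pos (by rw [saddleValue_eq]; positivity) hr0
  have hz : ∀ z ∈ Ioc (0 : ℝ) σ, meanUtility σ G z < ENNReal.ofReal (s / (1 - z)) := by
    intro z hz
    have hz1 : 0 < 1 - z := by linarith [hz.2]
    have h := hcon z ⟨hz.1.le, by linarith⟩
    rw [shareRatio, hr, EReal.div_lt_iff hpos (EReal.coe_ne_top r),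
      expectedSurplus_constantShare hσ0 G (by linarith), ← EReal.coe_mul, ← hs,
      show ((s : ℝ) : EReal) = ((ENNReal.ofReal s : ℝ≥0∞) : EReal) by
        rw [EReal.coe_ennreal_ofReal, max_eq_left hs0.le],
      EReal.coe_ennreal_lt_coe_ennreal_iff] at h
    rw [ENNReal.ofReal_div_of_pos hz1, ENNReal.lt_div_iff_mul_lt
      (Or.inl (ENNReal.ofReal_pos.2 hz1).ne') (Or.inl ENNReal.ofReal_ne_top), mul_comm]
    exact h
  have h1 : ∫⁻ z in Ioc 0 σ, meanUtility σ G z ≤ ENNReal.ofReal (s * -Real.log (1 - σ)) := by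
    rw [← lintegral_div_one_sub hσ0 hσ1 hs0.le]
    exact setLIntegral_mono' measurableSet_Ioc fun z hz' => (hz z hz').le
  have h2 : ENNReal.ofReal (tailWeight σ) * meanUtility σ G σ
      < ENNReal.ofReal (tailWeight σ) * ENNReal.ofReal (s / (1 - σ)) :=
    ENNReal.mul_lt_mul_right (ENNReal.ofReal_pos.2 (tailWeight_pos hσ0 hσ1)).ne'
      ENNReal.ofReal_ne_top (hz σ ⟨hσ0, le_rfl⟩)
  have h3 := (lintegral_efficientSurplus_le hσ0 hσ1 G).trans_lt
    (ENNReal.add_lt_add_of_le_of_lt (ne_top_of_le_ne_top ENNReal.ofReal_ne_top h1) h1 h2)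
  have hlog := Real.log_neg (show 0 < 1 - σ by linarith) (by linarith)
  rw [← ENNReal.ofReal_mul (tailWeight_pos hσ0 hσ1).le, ← ENNReal.ofReal_add
    (mul_nonneg hs0.le (by linarith))
    (mul_nonneg (tailWeight_pos hσ0 hσ1).le (div_nonneg hs0.le (by linarith)))] at h3
  have e : s * -Real.log (1 - σ) + tailWeight σ * (s / (1 - σ)) = r := by
    have h1σ : 1 - σ ≠ 0 := by linarith
    have : s * -Real.log (1 - σ) + tailWeight σ * (s / (1 - σ)) = s * saddleDenom σ := by
      simp only [tailWeight, saddleDenom]; field_simp; ring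
    rw [this, hs, saddleValue_eq]
    field_simp
  rw [e] at h3
  have h4 := EReal.coe_ennreal_lt_coe_ennreal_iff.2 h3
  rw [EReal.coe_ennreal_ofReal, max_eq_left hr0.le] at h4
  exact absurd hle (not_le.2 h4)

/-! ### The worst cost function -/

/-- The largest quantity `(1 - σ) ^ (-1 / σ)` up to which the marginal cost `q ^ (σ - 1) - 1 / q`
increases. -/
noncomputable def kinkTop (σ : ℝ) : ℝ := (1 - σ) ^ (-1 / σ)

/-- The worst cost on `[1, kinkTop σ]`: the primitive `(q ^ σ - 1) / σ - log q` of the marginal cost.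
Under it the share `z ∈ (0, σ]` induces `q ^ σ = 1 / (1 - z)`, so the buyer surplus
does not depend on `z`. -/
noncomputable def coreCost (σ q : ℝ) : ℝ := (q ^ σ - 1) / σ - Real.log q

/-- The marginal cost of `coreCost`. -/
noncomputable def coreSlope (σ q : ℝ) : ℝ := q ^ (σ - 1) - q⁻¹

/-- The worst cost function: the upper envelope of the tangents of `coreCost` at the quantities in
`[1, kinkTop σ]`. It vanishes up to the quantity `1` and is linear beyond `kinkTop σ`. -/
noncomputable def worstCost (σ : ℝ) (x : ℝ≥0) : ℝ :=
  ⨆ y : Icc 1 (kinkTop σ), (coreCost σ y + coreSlope σ y * (x - y))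

lemma one_le_kinkTop {σ : ℝ} (hσ0 : 0 < σ) (hσ1 : σ < 1) : 1 ≤ kinkTop σ :=
  Real.one_le_rpow_of_pos_of_le_one_of_nonpos (by linarith) (by linarith)
    (div_nonpos_of_nonpos_of_nonneg (by norm_num) hσ0.le)

lemma kinkTop_rpow {σ : ℝ} (hσ0 : 0 < σ) (hσ1 : σ < 1) : kinkTop σ ^ σ = (1 - σ)⁻¹ := by
  rw [kinkTop, ← Real.rpow_mul (by linarith), div_mul_cancel₀ _ hσ0.ne', Real.rpow_neg_one]

lemma rpow_le_of_le_kinkTop {σ x : ℝ} (hσ0 : 0 < σ) (hσ1 : σ < 1) (h1 : 1 ≤ x)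
    (hx : x ≤ kinkTop σ) : (1 - σ) * x ^ σ ≤ 1 := by
  have h := Real.rpow_le_rpow (by linarith) hx hσ0.le
  rw [kinkTop_rpow hσ0 hσ1, ← one_div, le_div_iff₀ (by linarith)] at h
  linarith

lemma coreSlope_eq {σ x : ℝ} (hx : 0 < x) : coreSlope σ x = (x ^ σ - 1) / x := by
  rw [coreSlope, Real.rpow_sub_one hx.ne']; field_simp

lemma coreSlope_nonneg {σ x : ℝ} (hσ0 : 0 < σ) (hx : 1 ≤ x) : 0 ≤ coreSlope σ x := by
  rw [coreSlope_eq (by linarith)]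
  have := Real.one_le_rpow hx hσ0.le
  exact div_nonneg (by linarith) (by linarith)

lemma coreSlope_monotoneOn {σ : ℝ} (hσ0 : 0 < σ) (hσ1 : σ < 1) :
    MonotoneOn (coreSlope σ) (Icc 1 (kinkTop σ)) := by
  intro y hy x hx hyx
  have hy0 : 0 < y := by linarith [hy.1]
  have hx0 : 0 < x := by linarith [hx.1]
  rw [coreSlope_eq hy0, coreSlope_eq hx0, div_le_div_iff₀ hy0 hx0]
  have h1 := rpow_le_tangent hσ0 hσ1 hy0.le hx0
  rw [Real.rpow_sub_one hx0.ne'] at h1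
  have h2 : x * (x ^ σ + σ * (x ^ σ / x) * (y - x)) = x * x ^ σ + σ * x ^ σ * (y - x) := by
    field_simp
  have h3 : x * y ^ σ ≤ x * x ^ σ + σ * x ^ σ * (y - x) := h2 ▸ by gcongr
  have h4 := mul_le_mul_of_nonneg_right (rpow_le_of_le_kinkTop hσ0 hσ1 hx.1 hx.2)
    (sub_nonneg.2 hyx)
  linarith

lemma hasDerivAt_coreCost {σ x : ℝ} (hσ0 : 0 < σ) (hx : 0 < x) :
    HasDerivAt (coreCost σ) (coreSlope σ x) x := by
  have h := (((Real.hasDerivAt_rpow_const (p := σ) (Or.inl hx.ne')).sub_const 1).div_const σ).sub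
    (Real.hasDerivAt_log hx.ne')
  refine h.congr_deriv ?_
  rw [coreSlope, mul_div_cancel_left₀ _ hσ0.ne']

lemma convexOn_coreCost {σ : ℝ} (hσ0 : 0 < σ) (hσ1 : σ < 1) :
    ConvexOn ℝ (Icc 1 (kinkTop σ)) (coreCost σ) := by
  have hd : ∀ x ∈ Icc 1 (kinkTop σ), HasDerivAt (coreCost σ) (coreSlope σ x) x := fun x hx =>
    hasDerivAt_coreCost hσ0 (by linarith [hx.1])
  refine MonotoneOn.convexOn_of_deriv (convex_Icc _ _)
    (fun x hx => (hd x hx).continuousAt.continuousWithinAt)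
    (fun x hx => (hd x (interior_subset hx)).differentiableAt.differentiableWithinAt) ?_
  intro x hx y hy hxy
  rw [(hd x (interior_subset hx)).deriv, (hd y (interior_subset hy)).deriv]
  exact coreSlope_monotoneOn hσ0 hσ1 (interior_subset hx) (interior_subset hy) hxy

lemma coreCost_tangent_le {σ x y : ℝ} (hσ0 : 0 < σ) (hσ1 : σ < 1) (hx : x ∈ Icc 1 (kinkTop σ))
    (hy : y ∈ Icc 1 (kinkTop σ)) :
    coreCost σ y + coreSlope σ y * (x - y) ≤ coreCost σ x := by
  have hd := hasDerivAt_coreCost hσ0 (show 0 < y by linarith [hy.1])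
  rcases lt_trichotomy x y with h | rfl | h
  · have := (convexOn_coreCost hσ0 hσ1).slope_le_of_hasDerivAt hx hy h hd
    rw [slope_def_field, div_le_iff₀ (by linarith)] at this
    linarith
  · simp
  · have := (convexOn_coreCost hσ0 hσ1).le_slope_of_hasDerivAt hy hx h hd
    rw [slope_def_field, le_div_iff₀ (by linarith)] at this
    linarith

lemma coreCost_one (σ : ℝ) : coreCost σ 1 = 0 := by simp [coreCost]

lemma coreSlope_one (σ : ℝ) : coreSlope σ 1 = 0 := by simp [coreSlope]

/-- The tangents of `coreCost` have nonpositive intercepts. -/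
lemma coreCost_intercept_nonpos {σ y : ℝ} (hσ0 : 0 < σ) (hσ1 : σ < 1)
    (hy : y ∈ Icc 1 (kinkTop σ)) : coreCost σ y + coreSlope σ y * (0 - y) ≤ 0 := by
  have h1 : (1 : ℝ) ∈ Icc 1 (kinkTop σ) := ⟨le_rfl, one_le_kinkTop hσ0 hσ1⟩
  have h2 := coreCost_tangent_le hσ0 hσ1 h1 hy
  have h3 := coreSlope_nonneg hσ0 hy.1
  rw [coreCost_one] at h2
  linarith

lemma bddAbove_tangents {σ : ℝ} (hσ0 : 0 < σ) (hσ1 : σ < 1) (x : ℝ≥0) :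
    BddAbove (range fun y : Icc 1 (kinkTop σ) =>
      coreCost σ y + coreSlope σ y * ((x : ℝ) - y)) := by
  refine ⟨coreSlope σ (kinkTop σ) * x, ?_⟩
  rintro _ ⟨⟨y, hy⟩, rfl⟩
  have h1 := coreCost_intercept_nonpos hσ0 hσ1 hy
  have h2 := coreSlope_monotoneOn hσ0 hσ1 hy ⟨one_le_kinkTop hσ0 hσ1, le_rfl⟩ hy.2
  have h3 := mul_le_mul_of_nonneg_right h2 x.2
  simp only
  simp only [NNReal.val_eq_coe] at h3
  linarith

lemma tangent_le_worstCost {σ y : ℝ} (hσ0 : 0 < σ) (hσ1 : σ < 1) (hy : y ∈ Icc 1 (kinkTop σ))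
    (x : ℝ≥0) : coreCost σ y + coreSlope σ y * (x - y) ≤ worstCost σ x :=
  le_ciSup (bddAbove_tangents hσ0 hσ1 x) ⟨y, hy⟩

lemma worstCost_le {σ b : ℝ} (hσ0 : 0 < σ) (hσ1 : σ < 1) {x : ℝ≥0}
    (h : ∀ y ∈ Icc 1 (kinkTop σ), coreCost σ y + coreSlope σ y * (x - y) ≤ b) :
    worstCost σ x ≤ b :=
  haveI : Nonempty (Icc 1 (kinkTop σ)) := ⟨⟨1, le_rfl, one_le_kinkTop hσ0 hσ1⟩⟩
  ciSup_le fun y => h y y.2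

/-- Beyond `kinkTop σ` the worst cost is at most its last tangent. -/
lemma worstCost_le_linear {σ : ℝ} (hσ0 : 0 < σ) (hσ1 : σ < 1) {x : ℝ≥0} (hx : kinkTop σ ≤ x) :
    worstCost σ x ≤ coreCost σ (kinkTop σ) + coreSlope σ (kinkTop σ) * (x - kinkTop σ) := by
  have hone := one_le_kinkTop hσ0 hσ1
  refine worstCost_le hσ0 hσ1 fun y hy => ?_
  have h1 := coreCost_tangent_le hσ0 hσ1 ⟨hone, le_rfl⟩ hy
  have h2 := coreSlope_monotoneOn hσ0 hσ1 hy ⟨hone, le_rfl⟩ hy.2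
  have h3 := mul_le_mul_of_nonneg_right h2 (sub_nonneg.2 hx)
  linarith

lemma worstCost_zero {σ : ℝ} (hσ0 : 0 < σ) (hσ1 : σ < 1) : worstCost σ 0 = 0 := by
  refine le_antisymm (worstCost_le hσ0 hσ1 fun y hy => ?_) ?_
  · simpa using coreCost_intercept_nonpos hσ0 hσ1 hy
  · simpa [coreCost_one, coreSlope_one] using
      tangent_le_worstCost hσ0 hσ1 ⟨le_rfl, one_le_kinkTop hσ0 hσ1⟩ 0

lemma coreSlope_kinkTop {σ : ℝ} (hσ0 : 0 < σ) (hσ1 : σ < 1) :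
    coreSlope σ (kinkTop σ) = σ * kinkTop σ ^ (σ - 1) := by
  have h := one_le_kinkTop hσ0 hσ1
  have h1 : 1 - σ ≠ 0 := by linarith
  rw [coreSlope_eq (by linarith), Real.rpow_sub_one (by linarith), kinkTop_rpow hσ0 hσ1]
  field_simp
  ring

lemma worstCost_mem {σ : ℝ} (hσ0 : 0 < σ) (hσ1 : σ < 1) : worstCost σ ∈ convexCosts := by
  have hone := one_le_kinkTop hσ0 hσ1
  have hnn : ∀ q, 0 ≤ worstCost σ q := fun q => by
    simpa [coreCost_one, coreSlope_one] using tangent_le_worstCost hσ0 hσ1 ⟨le_rfl, hone⟩ q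
  refine ⟨hnn, fun x x' hx => ?_, ⟨convex_univ, fun x _ x' _ a b ha hb hab => ?_⟩, ?_⟩
  · refine worstCost_le hσ0 hσ1 fun y hy => le_trans ?_ (tangent_le_worstCost hσ0 hσ1 hy x')
    have := coreSlope_nonneg hσ0 hy.1
    have hx' : (x : ℝ) ≤ x' := hx
    gcongr
  · refine worstCost_le hσ0 hσ1 fun y hy => ?_
    have h1 := tangent_le_worstCost hσ0 hσ1 hy x
    have h2 := tangent_le_worstCost hσ0 hσ1 hy x'
    have hab' : (a : ℝ) + b = 1 := by exact_mod_cast hab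
    have h3 := add_le_add (mul_le_mul_of_nonneg_left h1 a.2) (mul_le_mul_of_nonneg_left h2 b.2)
    simp only [smul_eq_mul, NNReal.coe_add, NNReal.coe_mul, NNReal.smul_def]
    refine le_trans (le_of_eq ?_) h3
    have e : (b : ℝ) = 1 - a := by linarith
    simp only [NNReal.val_eq_coe, e]
    ring
  · have hk : 0 < coreSlope σ (kinkTop σ) := by
      rw [coreSlope_kinkTop hσ0 hσ1]
      exact mul_pos hσ0 (Real.rpow_pos_of_pos (by linarith) _)
    -- at this quantity the tangent at `kinkTop σ` has a value of at least `1`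
    have hx0 : 0 ≤ kinkTop σ + (1 + |coreCost σ (kinkTop σ)|) / coreSlope σ (kinkTop σ) := by
      have : 0 ≤ (1 + |coreCost σ (kinkTop σ)|) / coreSlope σ (kinkTop σ) := by positivity
      linarith
    obtain ⟨x, hx⟩ : ∃ x : ℝ≥0, (x : ℝ) = kinkTop σ
        + (1 + |coreCost σ (kinkTop σ)|) / coreSlope σ (kinkTop σ) := ⟨⟨_, hx0⟩, rfl⟩
    refine ⟨x, ?_⟩
    have h := tangent_le_worstCost hσ0 hσ1 ⟨hone, le_rfl⟩ x
    rw [hx, add_sub_cancel_left, mul_div_cancel₀ _ hk.ne'] at h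
    rw [worstCost_zero hσ0 hσ1]
    linarith [neg_abs_le (coreCost σ (kinkTop σ))]

/-- A quantity `q` on the graph of the tangent at `y` maximizes the profit under the share `z` if
the marginal revenue at `q` equals the slope of that tangent. -/
lemma mem_bestResponses_worstCost {σ y z : ℝ} (hσ0 : 0 < σ) (hσ1 : σ < 1) (hz : 0 ≤ z)
    (hy : y ∈ Icc 1 (kinkTop σ)) {q : ℝ≥0} (hq : 0 < q)
    (hcost : worstCost σ q ≤ coreCost σ y + coreSlope σ y * (q - y))
    (hslope : z * (q : ℝ) ^ (σ - 1) = coreSlope σ y) :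
    q ∈ bestResponses (worstCost σ) (constantShare σ z) := by
  intro x
  have h1 := tangent_le_worstCost hσ0 hσ1 hy x
  have h2 := mul_le_mul_of_nonneg_left
    (utility_le_tangent hσ0 hσ1 x (show (0 : ℝ) < q from hq)) hz
  have h3 : z * ((q : ℝ) ^ σ / σ + (q : ℝ) ^ (σ - 1) * (x - q))
      = z * utility σ q + coreSlope σ y * (x - q) := by
    rw [← hslope, utility]; ring
  rw [h3] at h2
  simp only [constantShare]
  linarith

/-- Under the worst cost, no constant share leaves the buyer more than `1 / σ`. -/
lemma buyerSurplus_worstCost_le {σ z : ℝ} (hσ0 : 0 < σ) (hσ1 : σ < 1) (hz0 : 0 ≤ z)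
    (hz1 : z ≤ 1) : buyerSurplus σ (worstCost σ) (constantShare σ z) ≤ 1 / σ := by
  have hone := one_le_kinkTop hσ0 hσ1
  have hK : 0 < kinkTop σ := by linarith
  have h1σ : 0 < 1 - σ := by linarith
  -- it suffices to find some best response whose utility is small
  suffices h : ∃ q : ℝ≥0, q ∈ bestResponses (worstCost σ) (constantShare σ z) ∧
      (1 - z) * (q : ℝ) ^ σ ≤ 1 by
    obtain ⟨q, hq, hle⟩ := h
    rw [buyerSurplus_constantShare]
    have h1 : suppliedUtility σ (worstCost σ) z ≤ utility σ q :=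
      utility_mono hσ0 (csInf_le (OrderBot.bddBelow _) hq)
    calc (1 - z) * suppliedUtility σ (worstCost σ) z ≤ (1 - z) * utility σ q := by
          gcongr
      _ = (1 - z) * (q : ℝ) ^ σ / σ := by rw [utility]; ring
      _ ≤ 1 / σ := by gcongr
  rcases le_total z σ with hz | hz
  · -- `q ^ σ = 1 / (1 - z)`
    have hz' : 0 < 1 - z := by linarith
    set q : ℝ := (1 - z) ^ (-1 / σ) with hq
    have hq1 : 1 ≤ q := Real.one_le_rpow_of_pos_of_le_one_of_nonpos hz' (by linarith)
      (div_nonpos_of_nonpos_of_nonneg (by norm_num) hσ0.le)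
    have hqK : q ≤ kinkTop σ := Real.rpow_le_rpow_of_nonpos h1σ (by linarith)
      (div_nonpos_of_nonpos_of_nonneg (by norm_num) hσ0.le)
    have hqσ : q ^ σ = (1 - z)⁻¹ := by
      rw [hq, ← Real.rpow_mul hz'.le, div_mul_cancel₀ _ hσ0.ne', Real.rpow_neg_one]
    have hq0 : 0 < q := by linarith
    refine ⟨q.toNNReal, mem_bestResponses_worstCost hσ0 hσ1 hz0 ⟨hq1, hqK⟩
      (Real.toNNReal_pos.2 hq0) ?_ ?_, ?_⟩
    · refine worstCost_le hσ0 hσ1 fun y hy => ?_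
      rw [Real.coe_toNNReal _ hq0.le, sub_self, mul_zero, add_zero]
      exact coreCost_tangent_le hσ0 hσ1 ⟨hq1, hqK⟩ hy
    · rw [Real.coe_toNNReal _ hq0.le, coreSlope_eq hq0, Real.rpow_sub_one hq0.ne', hqσ]
      field_simp
      ring
    · rw [Real.coe_toNNReal _ hq0.le, hqσ, mul_inv_cancel₀ hz'.ne']
  · -- beyond the share `σ` the seller supplies on the linear piece
    have hzp : 0 < z := by linarith
    have hzσ : 1 ≤ z / σ := (one_le_div hσ0).2 hz
    have hr : 1 ≤ (z / σ) ^ (1 / (1 - σ)) := Real.one_le_rpow hzσ (by positivity)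
    have hr0 : 0 < (z / σ) ^ (1 / (1 - σ)) := by linarith
    set q : ℝ := kinkTop σ * (z / σ) ^ (1 / (1 - σ)) with hq
    have hqK : kinkTop σ ≤ q := le_mul_of_one_le_right hK.le hr
    have hq0 : 0 < q := by linarith
    refine ⟨q.toNNReal, mem_bestResponses_worstCost hσ0 hσ1 hz0 ⟨hone, le_rfl⟩
      (Real.toNNReal_pos.2 hq0) ?_ ?_, ?_⟩
    · exact worstCost_le_linear hσ0 hσ1 (by rwa [Real.coe_toNNReal _ hq0.le])
    · rw [Real.coe_toNNReal _ hq0.le, coreSlope_kinkTop hσ0 hσ1, hq, Real.mul_rpow hK.le hr0.le,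
        ← Real.rpow_mul (by positivity),
        show 1 / (1 - σ) * (σ - 1) = -1 by field_simp; ring, Real.rpow_neg_one]
      field_simp
    · -- weighted means: `((1 - z) / (1 - σ)) ^ (1 - σ) * (z / σ) ^ σ ≤ 1`
      have hw : 0 ≤ (1 - z) / (1 - σ) := div_nonneg (by linarith) h1σ.le
      have hgm := Real.geom_mean_le_arith_mean2_weighted h1σ.le hσ0.le hw
        (show 0 ≤ z / σ by positivity) (by ring)
      rw [mul_div_cancel₀ _ h1σ.ne', mul_div_cancel₀ _ hσ0.ne', sub_add_cancel] at hgm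
      have hpow := Real.rpow_le_rpow (by positivity) hgm (show 0 ≤ 1 / (1 - σ) by positivity)
      rw [Real.one_rpow, Real.mul_rpow (by positivity) (by positivity), ← Real.rpow_mul hw,
        mul_one_div_cancel h1σ.ne', Real.rpow_one, ← Real.rpow_mul (by positivity)] at hpow
      rw [Real.coe_toNNReal _ hq0.le, hq, Real.mul_rpow hK.le hr0.le, kinkTop_rpow hσ0 hσ1,
        ← Real.rpow_mul (by positivity), mul_comm (1 / (1 - σ)) σ]
      refine le_trans (le_of_eq ?_) hpow
      field_simp

/-- The quantity that is efficient for the worst cost. -/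
noncomputable def efficientQuantity (σ : ℝ) : ℝ := kinkTop σ * σ ^ (-1 / (1 - σ))

/-- The efficient surplus under the worst cost is at least `saddleDenom σ / σ`. -/
lemma saddleDenom_div_le {σ : ℝ} (hσ0 : 0 < σ) (hσ1 : σ < 1) {q : ℝ≥0}
    (hq : (q : ℝ) = efficientQuantity σ) :
    saddleDenom σ / σ ≤ utility σ q - worstCost σ q := by
  have hone := one_le_kinkTop hσ0 hσ1
  have hK : 0 < kinkTop σ := by linarith
  have h1σ : 0 < 1 - σ := by linarith
  have hs0 : 0 < σ ^ (-1 / (1 - σ)) := Real.rpow_pos_of_pos hσ0 _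
  have hs : 1 ≤ σ ^ (-1 / (1 - σ)) := Real.one_le_rpow_of_pos_of_le_one_of_nonpos hσ0 hσ1.le
    (div_nonpos_of_nonpos_of_nonneg (by norm_num) h1σ.le)
  have hqK : kinkTop σ ≤ q := hq ▸ le_mul_of_one_le_right hK.le hs
  have hcost : worstCost σ q
      ≤ coreCost σ (kinkTop σ) + coreSlope σ (kinkTop σ) * (q - kinkTop σ) :=
    worstCost_le_linear hσ0 hσ1 hqK
  have hu : utility σ q = (1 - σ)⁻¹ * σ ^ (-σ / (1 - σ)) / σ := by
    rw [utility, hq, efficientQuantity, Real.mul_rpow hK.le hs0.le, kinkTop_rpow hσ0 hσ1,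
      ← Real.rpow_mul hσ0.le, show -1 / (1 - σ) * σ = -σ / (1 - σ) by ring]
  have hlog : Real.log (kinkTop σ) = -Real.log (1 - σ) / σ := by
    rw [kinkTop, Real.log_rpow h1σ]; ring
  have hlin : coreSlope σ (kinkTop σ) * (q - kinkTop σ)
      = σ * (1 - σ)⁻¹ * (σ ^ (-σ / (1 - σ)) / σ - 1) := by
    rw [coreSlope_kinkTop hσ0 hσ1, hq, efficientQuantity, rpow_neg_one_div hσ0 hσ1,
      Real.rpow_sub_one hK.ne', kinkTop_rpow hσ0 hσ1]
    field_simp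
  rw [hlin, coreCost, kinkTop_rpow hσ0 hσ1, hlog] at hcost
  rw [hu]
  refine le_trans (le_of_eq ?_) (sub_le_sub_left hcost _)
  rw [saddleDenom]
  field_simp
  ring

/-! ### The prior concentrated on the worst cost -/

/-- The prior concentrated on a single cost function. -/
noncomputable def pointPrior (c : convexCosts) : ProbabilityMeasure convexCosts :=
  ⟨Measure.dirac c, inferInstance⟩

lemma expectedGain_pointPrior (σ : ℝ) (c : convexCosts) (t : ℝ≥0 → ℝ) :
    expectedGain σ (pointPrior c) t = ENNReal.ofReal (buyerSurplus σ c t) :=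
  lintegral_dirac c fun c' : convexCosts => ENNReal.ofReal (buyerSurplus σ c' t)

lemma expectedLoss_pointPrior (σ : ℝ) (c : convexCosts) (t : ℝ≥0 → ℝ) :
    expectedLoss σ (pointPrior c) t = ENNReal.ofReal (-buyerSurplus σ c t) :=
  lintegral_dirac c fun c' : convexCosts => ENNReal.ofReal (-buyerSurplus σ c' t)

lemma expectedSurplus_pointPrior (σ : ℝ) (c : convexCosts) (t : ℝ≥0 → ℝ) :
    expectedSurplus σ (pointPrior c) t = (buyerSurplus σ c t : EReal) := by
  rw [expectedSurplus, expectedGain_pointPrior, expectedLoss_pointPrior,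
    EReal.coe_ennreal_ofReal, EReal.coe_ennreal_ofReal, ← EReal.coe_sub]
  congr 1
  exact max_zero_sub_eq_self _

lemma pointPrior_mem_priors {σ : ℝ} (hσ0 : 0 < σ) (hσ1 : σ < 1) (c : convexCosts) :
    pointPrior c ∈ priors σ := by
  refine (bayesSurplus_le hσ0 hσ1 (pointPrior c)).trans_lt ?_
  have : ∫⁻ c' : convexCosts, ENNReal.ofReal (efficientSurplus σ c')
      ∂(pointPrior c : Measure convexCosts) = ENNReal.ofReal (efficientSurplus σ c) :=
    lintegral_dirac c fun c' : convexCosts => ENNReal.ofReal (efficientSurplus σ c')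
  rw [this, EReal.coe_ennreal_ofReal]
  exact EReal.coe_lt_top _

/-- A buyer who knows the cost obtains `u(q) - c(q)` for every `q > 0` up to an
arbitrarily small amount `ε`, by paying `c(q) + ε` for the quantity `q` and nothing for others. -/
lemma le_bayesSurplus_pointPrior {σ : ℝ} (c : convexCosts) {q : ℝ≥0} (hq : 0 < q) :
    ((utility σ q - (c : ℝ≥0 → ℝ) q : ℝ) : EReal) ≤ bayesSurplus σ (pointPrior c) := by
  have key : ∀ ε : ℝ, 0 < ε →
      ((utility σ q - (c : ℝ≥0 → ℝ) q - ε : ℝ) : EReal) ≤ bayesSurplus σ (pointPrior c) := by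
    intro ε hε
    set t : ℝ≥0 → ℝ := fun x => if x = q then (c : ℝ≥0 → ℝ) q + ε else 0 with ht
    have htq : t q = (c : ℝ≥0 → ℝ) q + ε := if_pos rfl
    have hne : ∀ x, x ≠ q → t x = 0 := fun x hx => if_neg hx
    have hbest : bestResponses c t = {q} := by
      ext x
      rw [mem_singleton_iff]
      constructor
      · intro hx
        by_contra hxq
        have h1 := hx q
        rw [htq, hne x hxq] at h1
        linarith [c.2.1 x]
      · rintro rfl x'
        rw [htq]
        rcases eq_or_ne x' x with rfl | hx'
        · rw [htq]
        · rw [hne x' hx']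
          linarith [c.2.1 x']
    have hsurplus : buyerSurplus σ c t = utility σ q - (c : ℝ≥0 → ℝ) q - ε := by
      rw [buyerSurplus, supply, hbest, csInf_singleton, htq]; ring
    have hmem : t ∈ mechanisms σ (pointPrior c) := by
      refine ⟨hne 0 hq.ne, fun x => ?_, ?_, aemeasurable_dirac, Or.inl ?_⟩
      · rcases eq_or_ne x q with rfl | hx
        · rw [htq]; linarith [c.2.1 x]
        · rw [hne x hx]
      · change ∀ᵐ c' ∂(Measure.dirac c), _
        rw [ae_dirac_eq]
        exact ⟨q, by rw [hbest]; exact isLeast_singleton⟩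
      · rw [expectedGain_pointPrior]; exact ENNReal.ofReal_ne_top
    rw [← hsurplus, ← expectedSurplus_pointPrior]
    exact le_iSup₂_of_le t hmem le_rfl
  refine EReal.ge_of_forall_gt_iff_ge.1 fun v hv => ?_
  have h := key (utility σ q - (c : ℝ≥0 → ℝ) q - v) (sub_pos.2 (EReal.coe_lt_coe_iff.1 hv))
  rwa [sub_sub_cancel] at h

/-- Against the prior concentrated on the worst cost no constant share obtains more than the saddle
value. -/
lemma shareRatio_worstCost_le {σ : ℝ} (hσ0 : 0 < σ) (hσ1 : σ < 1) {z : ℝ}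
    (hz : z ∈ Icc (0 : ℝ) 1) :
    shareRatio σ (pointPrior ⟨worstCost σ, worstCost_mem hσ0 hσ1⟩) z ≤ (saddleValue σ : EReal) := by
  set c : convexCosts := ⟨worstCost σ, worstCost_mem hσ0 hσ1⟩
  have hD := saddleDenom_pos hσ0 hσ1
  have hq0 : 0 < efficientQuantity σ :=
    mul_pos (by linarith [one_le_kinkTop hσ0 hσ1]) (Real.rpow_pos_of_pos hσ0 _)
  have h1 := saddleDenom_div_le hσ0 hσ1 (Real.coe_toNNReal _ hq0.le)
  have h2 := le_bayesSurplus_pointPrior (σ := σ) c (Real.toNNReal_pos.2 hq0)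
  have h3 : ((saddleDenom σ / σ : ℝ) : EReal) ≤ bayesSurplus σ (pointPrior c) :=
    (EReal.coe_le_coe_iff.2 h1).trans h2
  have hfin : bayesSurplus σ (pointPrior c) < ⊤ := pointPrior_mem_priors hσ0 hσ1 c
  rw [shareRatio, EReal.div_le_iff_le_mul (bayesSurplus_pos hσ0 hσ1 _) hfin.ne,
    expectedSurplus_pointPrior]
  have hB : 0 ≤ saddleValue σ := by rw [saddleValue_eq]; positivity
  calc ((buyerSurplus σ c (constantShare σ z) : ℝ) : EReal)
      ≤ ((1 / σ : ℝ) : EReal) :=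
        EReal.coe_le_coe_iff.2 (buyerSurplus_worstCost_le hσ0 hσ1 hz.1 hz.2)
    _ = ((saddleDenom σ / σ : ℝ) : EReal) * (saddleValue σ : EReal) := by
        rw [← EReal.coe_mul, saddleValue_eq]
        congr 1
        field_simp
    _ ≤ bayesSurplus σ (pointPrior c) * (saddleValue σ : EReal) :=
        mul_le_mul_of_nonneg_right h3 (EReal.coe_nonneg.2 hB)

end Procurement

theorem proposition7 (σ : ℝ) (hσ0 : 0 < σ) (hσ1 : σ < 1) :
    IsLeast {v : EReal | ∃ G ∈ Procurement.priors σ,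
        v = ⨆ z ∈ Set.Icc (0 : ℝ) 1, Procurement.shareRatio σ G z}
      (Procurement.saddleValue σ : EReal) ∧
    (∀ G ∈ Procurement.priors σ, ∃ z ∈ Set.Icc (0 : ℝ) 1,
      (Procurement.saddleValue σ : EReal) ≤ Procurement.shareRatio σ G z) ∧
    (∃ G ∈ Procurement.priors σ,
      (∀ᵐ c : Procurement.convexCosts ∂(G : MeasureTheory.Measure Procurement.convexCosts),
        (c : NNReal → ℝ) 0 = 0) ∧
      IsGreatest (Procurement.shareRatio σ G '' Set.Icc (0 : ℝ) 1)
        (Procurement.saddleValue σ : EReal)) := by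
  have hlow : ∀ G ∈ Procurement.priors σ, ∃ z ∈ Set.Icc (0 : ℝ) 1,
      (Procurement.saddleValue σ : EReal) ≤ Procurement.shareRatio σ G z :=
    fun G hG => Procurement.exists_saddleValue_le_shareRatio hσ0 hσ1 hG
  have hmem := Procurement.pointPrior_mem_priors hσ0 hσ1
    ⟨Procurement.worstCost σ, Procurement.worstCost_mem hσ0 hσ1⟩
  have hup : ∀ z ∈ Set.Icc (0 : ℝ) 1, _ := fun z hz =>
    Procurement.shareRatio_worstCost_le hσ0 hσ1 hz
  obtain ⟨z₀, hz₀, hle₀⟩ := hlow _ hmem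
  refine ⟨⟨⟨_, hmem, le_antisymm (le_iSup₂_of_le z₀ hz₀ hle₀) (iSup₂_le hup)⟩, ?_⟩, hlow,
    _, hmem, ?_, ⟨z₀, hz₀, le_antisymm (hup z₀ hz₀) hle₀⟩, ?_⟩
  · rintro _ ⟨G, hG, rfl⟩
    obtain ⟨z, hz, hle⟩ := hlow G hG
    exact le_iSup₂_of_le z hz hle
  · change ∀ᵐ c ∂(MeasureTheory.Measure.dirac _), _
    rw [MeasureTheory.ae_dirac_eq]
    exact Procurement.worstCost_zero hσ0 hσ1
  · rintro _ ⟨z, hz, rfl⟩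
    exact hup z hz
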